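/- Let $n,m\ge 0$ be integers and $q=\max(n,m)$. Consider the two-user symmetric deterministic interference channel with $n$ direct and $m$ cross levels: in each channel use transmitter $k\in\{1,2\}$ sends a vector $X_k\in\mathbb F_2^q$ (most significant bit first), and the receivers observe $$Y_1=\mathbf S^{q-n}X_1\oplus \mathbf S^{q-m}X_2,\qquad Y_2=\mathbf S^{q-m}X_1\oplus \mathbf S^{q-n}X_2,$$ where $\mathbf S$ is the $q\times q$ down-shift matrix. The messages $W_1,W_2$ are independent and uniformly distributed on $\{1,\dots,M_1\}$ and $\{1,\dots,M_2\}$, and receiver $k$ has to decode $W_k$ from its outputs in $N$ channel uses. With a single dedicated feedback link from receiver 1 to transmitter 1, the input of transmitter 1 at time $i$ is a function of $W_1$ and the past outputs $Y_{1,1},\dots,Y_{1,i-1}$, and the input of transmitter 2 at time $i$ is a function of $W_2$ only. A pair $(R_1,R_2)$ of non-negative rates is achievable if there are codes for all large block lengths $N$ with at least $2^{NR_k}$ messages for user $k=1,2$ and with both decoding error probabilities tending to $0$ as $N\to\infty$; the capacity region is the closure of the set of achievable pairs, and the sum capacity is $C_{\mathrm{sum}}=\sup\{R_1+R_2\}$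 over the capacity region. Then, with the single feedback link, $$C_{\mathrm{sum}}=\max(n,m)+(n-m)^+,\qquad (x)^+=\max(x,0).$$ This is the same value as with two dedicated feedback links, one from each receiver to its own transmitter (where the input of transmitter $2$ at time $i$ may also depend on $Y_{2,1},\dots,Y_{2,i-1}$). -/

import Mathlib

namespace SymDetIC

/-- A transmitted or received vector of `q` bit levels, the most significant bit at index `0`. -/
abbrev Levels (q : ℕ) : Type := Fin q → ZMod 2

/-- The `q × q` matrix that shifts a vector down by `q - l` positions (for `l ≤ q`), so that only
the `l` most significant bits of the vector survive, on the `l` lowest levels. -/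
def shiftMatrix (q l : ℕ) : Matrix (Fin q) (Fin q) (ZMod 2) :=
  Matrix.of fun r c => if (r : ℕ) = (q - l) + (c : ℕ) then 1 else 0

/-- Output at receiver 1 of the symmetric deterministic interference channel with `n` direct and
`m` cross levels, for the inputs `x₁`, `x₂` of the two transmitters. Addition is bitwise XOR. -/
def output₁ (n m : ℕ) (x₁ x₂ : Levels (max n m)) : Levels (max n m) :=
  (shiftMatrix (max n m) n).mulVec x₁ + (shiftMatrix (max n m) m).mulVec x₂

/-- Output at receiver 2. -/
def output₂ (n m : ℕ) (x₁ x₂ : Levels (max n m)) : Levels (max n m) :=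
  (shiftMatrix (max n m) m).mulVec x₁ + (shiftMatrix (max n m) n).mulVec x₂

/-- A block code of length `N` with `M₁` and `M₂` messages. The input of transmitter `k` at time
`t` (counted from `0`) is a function `enc k t` of its message and of the `t` past outputs at its
own receiver; only the times `t < N` are used. Receiver `k` decodes from its `N` outputs. -/
structure Code (n m N M₁ M₂ : ℕ) where
  /-- encoder of transmitter 1 -/
  enc₁ : (t : ℕ) → Fin M₁ → (Fin t → Levels (max n m)) → Levels (max n m)
  /-- encoder of transmitter 2 -/
  enc₂ : (t : ℕ) → Fin M₂ → (Fin t → Levels (max n m)) → Levels (max n m)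
  /-- decoder of receiver 1 -/
  dec₁ : (Fin N → Levels (max n m)) → Fin M₁
  /-- decoder of receiver 2 -/
  dec₂ : (Fin N → Levels (max n m)) → Fin M₂

/-- The feedback links that are present. -/
inductive FeedbackModel
  /-- a single link, from receiver 1 to transmitter 1 -/
  | oneLink
  /-- two links, from each receiver to its own transmitter -/
  | twoLink

variable {n m N M₁ M₂ : ℕ}

/-- A code uses only the feedback links of the model: with one link, the input of transmitter 2
is a function of the time and of its message alone. -/
def Code.Uses (c : Code n m N M₁ M₂) : FeedbackModel → Prop
  | .oneLink => ∀ t w y y', c.enc₂ t w y = c.enc₂ t w y'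
  | .twoLink => True

/-- The first `t` outputs at the two receivers when the messages are `w₁` and `w₂`. -/
def Code.outputs (c : Code n m N M₁ M₂) (w₁ : Fin M₁) (w₂ : Fin M₂) :
    (t : ℕ) → (Fin t → Levels (max n m)) × (Fin t → Levels (max n m))
  | 0 => (Fin.elim0, Fin.elim0)
  | t + 1 =>
    let y := c.outputs w₁ w₂ t
    let x₁ := c.enc₁ t w₁ y.1
    let x₂ := c.enc₂ t w₂ y.2
    (Fin.snoc y.1 (output₁ n m x₁ x₂), Fin.snoc y.2 (output₂ n m x₁ x₂))

/-- Probability that receiver 1 decodes its message wrongly, for independent, uniformly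
distributed messages (that is, for a uniformly distributed message pair). -/
noncomputable def Code.errorProb₁ (c : Code n m N M₁ M₂) : ℝ :=
  ((Finset.univ.filter fun w : Fin M₁ × Fin M₂ =>
    c.dec₁ (c.outputs w.1 w.2 N).1 ≠ w.1).card : ℝ) / ((M₁ : ℝ) * (M₂ : ℝ))

/-- Probability that receiver 2 decodes its message wrongly. -/
noncomputable def Code.errorProb₂ (c : Code n m N M₁ M₂) : ℝ :=
  ((Finset.univ.filter fun w : Fin M₁ × Fin M₂ =>
    c.dec₂ (c.outputs w.1 w.2 N).2 ≠ w.2).card : ℝ) / ((M₁ : ℝ) * (M₂ : ℝ))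

/-- The rate pair `R` (in bits per channel use) is achievable: for every `ε > 0` and all large
block lengths `N` there is a code with at least `2 ^ (N R₁)` and `2 ^ (N R₂)` messages whose two
error probabilities are at most `ε`. -/
def Achievable (F : FeedbackModel) (n m : ℕ) (R : ℝ × ℝ) : Prop :=
  0 ≤ R.1 ∧ 0 ≤ R.2 ∧ ∀ ε : ℝ, 0 < ε → ∃ N₀ : ℕ, ∀ N : ℕ, N₀ ≤ N →
    ∃ (M₁ M₂ : ℕ) (c : Code n m N M₁ M₂), c.Uses F ∧
      (2 : ℝ) ^ ((N : ℝ) * R.1) ≤ (M₁ : ℝ) ∧ (2 : ℝ) ^ ((N : ℝ) * R.2) ≤ (M₂ : ℝ) ∧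
      c.errorProb₁ ≤ ε ∧ c.errorProb₂ ≤ ε

/-- The capacity region: the closure of the set of achievable rate pairs. -/
def capacityRegion (F : FeedbackModel) (n m : ℕ) : Set (ℝ × ℝ) :=
  closure {R | Achievable F n m R}

/-- `C` is the sum capacity: the supremum of `R₁ + R₂` over the capacity region. -/
def IsSumCapacity (F : FeedbackModel) (n m : ℕ) (C : ℝ) : Prop :=
  IsLUB ((fun R : ℝ × ℝ => R.1 + R.2) '' capacityRegion F n m) C

end SymDetIC

namespace SymDetIC

/-! ### Shift matrices and their partial inverse -/

section Shift

variable {q l : ℕ}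

/-! Converse, by counting: a correctly decoded message pair is determined by receiver 1's outputs
together with the `n - m` private bits of user 2 per channel use (`Code.injOn_good`). The outputs
give message 1 and hence all inputs of user 1, even with feedback; removing these leaves the cross
levels of user 2, and the private bits complete them to receiver 2's outputs. The bound holds for
two links.

Achievability with one link: user 2 sends uncoded bits and is silent at the end. User 1 puts `n - m`
fresh bits on its low levels and, on its top `m` levels, the interference that receiver 1 saw one
channel use earlier. This lets receiver 1 cancel interference backwards, while receiver 2 is
disturbed only by its own earlier bits (`shiftMatrix_mulVec_relayInput_succ`). -/

lemma shiftMatrix_mulVec_apply (x : Levels q) (r : Fin q) :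
    (shiftMatrix q l).mulVec x r =
      if q - l ≤ (r : ℕ) then x ⟨r - (q - l), by omega⟩ else 0 := by
  unfold shiftMatrix Matrix.mulVec dotProduct
  simp only [Matrix.of_apply, ite_mul, one_mul, zero_mul]
  split_ifs with h
  · rw [Finset.sum_eq_single (⟨r - (q - l), by omega⟩ : Fin q)]
    · rw [if_pos]
      simp only
      omega
    · intro c _ hc
      rw [if_neg]
      intro h'
      apply hc
      ext
      simp only
      omega
    · simp
  · refine Finset.sum_eq_zero fun c _ => if_neg ?_
    omega

lemma shiftMatrix_mulVec_self (x : Levels q) : (shiftMatrix q q).mulVec x = x := by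
  ext r
  simp [shiftMatrix_mulVec_apply]

/-- The shift retains exactly the `l` most significant bits. -/
lemma shiftMatrix_mulVec_eq_iff (hl : l ≤ q) (x y : Levels q) :
    (shiftMatrix q l).mulVec x = (shiftMatrix q l).mulVec y ↔
      ∀ c : Fin q, (c : ℕ) < l → x c = y c := by
  constructor
  · intro h c hc
    have := congrFun h ⟨q - l + c, by omega⟩
    simpa [shiftMatrix_mulVec_apply] using this
  · intro h
    ext r
    rw [shiftMatrix_mulVec_apply, shiftMatrix_mulVec_apply]
    split_ifs
    · apply h
      simp only
      omega
    · rfl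

/-- Shift up by `q - l` positions. -/
def liftTop (q l : ℕ) (v : Levels q) : Levels q := fun c =>
  if h : (c : ℕ) < l ∧ l ≤ q then v ⟨q - l + c, by omega⟩ else 0

/-- Resending the lifted interference recreates it exactly at the other receiver, although the lower
bits of `x` are lost. -/
lemma shiftMatrix_mulVec_liftTop (hl : l ≤ q) (x : Levels q) :
    (shiftMatrix q l).mulVec (liftTop q l ((shiftMatrix q l).mulVec x)) =
      (shiftMatrix q l).mulVec x := by
  rw [shiftMatrix_mulVec_eq_iff hl]
  intro c hc
  simp [liftTop, hc, hl, shiftMatrix_mulVec_apply]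

lemma liftTop_apply_of_le (v : Levels q) (c : Fin q) (hc : l ≤ c) : liftTop q l v c = 0 := by
  rw [liftTop, dif_neg]
  omega

end Shift

/-! ### Unrolling the feedback recursion -/

section Outputs

variable {n m N M₁ M₂ : ℕ}

/-- Input of transmitter 1 at time `t`. -/
def Code.input₁ (c : Code n m N M₁ M₂) (w : Fin M₁ × Fin M₂) (t : ℕ) : Levels (max n m) :=
  c.enc₁ t w.1 (c.outputs w.1 w.2 t).1

/-- Input of transmitter 2 at time `t`. -/
def Code.input₂ (c : Code n m N M₁ M₂) (w : Fin M₁ × Fin M₂) (t : ℕ) : Levels (max n m) :=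
  c.enc₂ t w.2 (c.outputs w.1 w.2 t).2

lemma Code.outputs_fst (c : Code n m N M₁ M₂) (w : Fin M₁ × Fin M₂) (t : ℕ) :
    (c.outputs w.1 w.2 t).1 = fun i : Fin t => output₁ n m (c.input₁ w i) (c.input₂ w i) := by
  induction t with
  | zero => ext i; exact i.elim0
  | succ t ih =>
    funext i
    refine Fin.lastCases ?_ (fun j => ?_) i
    · simp [Code.outputs, Code.input₁, Code.input₂]
    · simp only [Code.outputs, Fin.snoc_castSucc, Fin.val_castSucc]
      rw [ih]

lemma Code.outputs_snd (c : Code n m N M₁ M₂) (w : Fin M₁ × Fin M₂) (t : ℕ) :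
    (c.outputs w.1 w.2 t).2 = fun i : Fin t => output₂ n m (c.input₁ w i) (c.input₂ w i) := by
  induction t with
  | zero => ext i; exact i.elim0
  | succ t ih =>
    funext i
    refine Fin.lastCases ?_ (fun j => ?_) i
    · simp [Code.outputs, Code.input₁, Code.input₂]
    · simp only [Code.outputs, Fin.snoc_castSucc, Fin.val_castSucc]
      rw [ih]

end Outputs

/-! ### Upper bound by counting -/

section Converse

variable {n m N M₁ M₂ : ℕ}

/-- The bits of the input of transmitter 2 that reach receiver 2 but not receiver 1. -/
def privateBits (n m : ℕ) (x : Levels (max n m)) : Fin (n - m) → ZMod 2 := fun j =>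
  x ⟨m + j, by omega⟩

lemma shiftMatrix_mulVec_eq_of_privateBits {x y : Levels (max n m)}
    (h : (shiftMatrix (max n m) m).mulVec x = (shiftMatrix (max n m) m).mulVec y)
    (h' : privateBits n m x = privateBits n m y) :
    (shiftMatrix (max n m) n).mulVec x = (shiftMatrix (max n m) n).mulVec y := by
  rw [shiftMatrix_mulVec_eq_iff (le_max_right _ _)] at h
  rw [shiftMatrix_mulVec_eq_iff (le_max_left _ _)]
  intro c hc
  by_cases hm : (c : ℕ) < m
  · exact h c hm
  · have := congrFun h' ⟨c - m, by omega⟩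
    simp only [privateBits] at this
    convert this using 2 <;> ext <;> simp only <;> omega

/-- The message pairs that both receivers decode correctly. -/
def Code.good (c : Code n m N M₁ M₂) : Finset (Fin M₁ × Fin M₂) :=
  Finset.univ.filter fun w =>
    c.dec₁ (c.outputs w.1 w.2 N).1 = w.1 ∧ c.dec₂ (c.outputs w.1 w.2 N).2 = w.2

/-- The outputs at receiver 1 and the private bits of user 2 determine a correctly decoded
message pair. -/
lemma Code.injOn_good (c : Code n m N M₁ M₂) :
    Set.InjOn (fun w => ((c.outputs w.1 w.2 N).1,
      fun i : Fin N => privateBits n m (c.input₂ w i))) (c.good : Set (Fin M₁ × Fin M₂)) := by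
  intro w hw w' hw' h
  simp only [Code.good, Finset.coe_filter, Finset.mem_univ, true_and, Set.mem_ofPred_eq] at hw hw'
  obtain ⟨h1, h2⟩ := Prod.mk.inj h
  have e1 : w.1 = w'.1 := by rw [← hw.1, ← hw'.1, h1]
  rw [c.outputs_fst, c.outputs_fst] at h1
  have hy : ∀ t < N, output₁ n m (c.input₁ w t) (c.input₂ w t) =
      output₁ n m (c.input₁ w' t) (c.input₂ w' t) := fun t ht => congrFun h1 ⟨t, ht⟩
  -- Transmitter 1 knows nothing beyond its message and the outputs at receiver 1.
  have hx : ∀ t < N, c.input₁ w t = c.input₁ w' t := by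
    intro t ht
    simp only [Code.input₁]
    rw [c.outputs_fst, c.outputs_fst, e1]
    congr 1
    funext i
    exact hy i (i.2.trans ht)
  have e2 : w.2 = w'.2 := by
    rw [← hw.2, ← hw'.2, c.outputs_snd, c.outputs_snd]
    congr 1
    funext i
    have hv := hy i i.2
    simp only [output₁, hx i i.2, add_right_inj] at hv
    simp only [output₂, hx i i.2, add_right_inj]
    exact shiftMatrix_mulVec_eq_of_privateBits hv (congrFun h2 i)
  exact Prod.ext e1 e2

lemma Code.card_good_le (c : Code n m N M₁ M₂) :
    c.good.card ≤ 2 ^ (N * (max n m + (n - m))) := by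
  have := Finset.card_le_card_of_injOn _ (fun w _ => Finset.mem_univ _) c.injOn_good
  refine this.trans (le_of_eq ?_)
  simp only [Finset.card_univ, Fintype.card_prod, Fintype.card_fun, Fintype.card_fin, ZMod.card]
  rw [← pow_mul, ← pow_mul, ← pow_add]
  ring_nf

lemma Code.card_le_good (c : Code n m N M₁ M₂) :
    (M₁ : ℝ) * M₂ * (1 - c.errorProb₁ - c.errorProb₂) ≤ c.good.card := by
  -- Without message pairs the error probabilities are divisions by zero.
  rcases eq_or_ne ((M₁ : ℝ) * M₂) 0 with h0 | h0
  · simp [h0]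
  have hle : M₁ * M₂ ≤ c.good.card +
      ((Finset.univ.filter fun w : Fin M₁ × Fin M₂ =>
        c.dec₁ (c.outputs w.1 w.2 N).1 ≠ w.1).card +
      (Finset.univ.filter fun w : Fin M₁ × Fin M₂ =>
        c.dec₂ (c.outputs w.1 w.2 N).2 ≠ w.2).card) := by
    calc M₁ * M₂ = (Finset.univ : Finset (Fin M₁ × Fin M₂)).card := by simp
      _ ≤ (c.good ∪ ((Finset.univ.filter fun w : Fin M₁ × Fin M₂ =>
            c.dec₁ (c.outputs w.1 w.2 N).1 ≠ w.1) ∪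
          (Finset.univ.filter fun w : Fin M₁ × Fin M₂ =>
            c.dec₂ (c.outputs w.1 w.2 N).2 ≠ w.2))).card := by
        apply Finset.card_le_card
        intro w _
        simp only [Code.good, Finset.mem_union, Finset.mem_filter, Finset.mem_univ, true_and]
        tauto
      _ ≤ _ := (Finset.card_union_le _ _).trans
        (Nat.add_le_add_left (Finset.card_union_le _ _) _)
  have hle' := (Nat.cast_le (α := ℝ)).2 hle
  rw [Nat.cast_add, Nat.cast_add, Nat.cast_mul] at hle'
  rw [mul_sub, mul_sub, mul_one, Code.errorProb₁, Code.errorProb₂, mul_div_cancel₀ _ h0,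
    mul_div_cancel₀ _ h0]
  linarith

lemma Achievable.rate_add_le {F : FeedbackModel} {R : ℝ × ℝ} (h : Achievable F n m R) :
    R.1 + R.2 ≤ ((max n m + (n - m) : ℕ) : ℝ) := by
  obtain ⟨-, -, h⟩ := h
  -- Two errors of at most `1 / 4` leave half of the pairs good; that factor 2 costs one bit in
  -- total, less than the excess `N * (R.1 + R.2 - C)` for large `N`.
  obtain ⟨N₀, hN₀⟩ := h (1 / 4) (by norm_num)
  by_contra! hlt
  obtain ⟨k, hk⟩ := exists_nat_gt (1 / (R.1 + R.2 - ((max n m + (n - m) : ℕ) : ℝ)))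
  obtain ⟨N, hN, hkN'⟩ : ∃ N, N₀ ≤ N ∧ k ≤ N := ⟨max N₀ k, le_max_left _ _, le_max_right _ _⟩
  obtain ⟨M₁, M₂, c, -, h1, h2, he1, he2⟩ := hN₀ N hN
  have hkN : (k : ℝ) ≤ N := by exact_mod_cast hkN'
  set C := max n m + (n - m)
  have hgap : 1 < (N : ℝ) * (R.1 + R.2 - C) := by
    rw [← div_lt_iff₀ (sub_pos.2 hlt)]
    exact hk.trans_le hkN
  have hM : (2 : ℝ) ^ ((N : ℝ) * (R.1 + R.2)) ≤ (M₁ : ℝ) * M₂ := by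
    rw [mul_add, Real.rpow_add (by norm_num)]
    exact mul_le_mul h1 h2 (by positivity) (by positivity)
  have hg : (c.good.card : ℝ) ≤ (2 : ℝ) ^ ((N : ℝ) * C) := by
    have : (c.good.card : ℝ) ≤ (2 : ℝ) ^ (N * C) := by exact_mod_cast c.card_good_le
    refine this.trans (le_of_eq ?_)
    rw [← Real.rpow_natCast]
    push_cast
    rfl
  have hle : (M₁ : ℝ) * M₂ ≤ 2 * c.good.card := by
    have := c.card_le_good
    have h0 : (0 : ℝ) ≤ (M₁ : ℝ) * M₂ := by positivity
    nlinarith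
  have : (2 : ℝ) ^ ((N : ℝ) * (R.1 + R.2)) ≤ (2 : ℝ) ^ (1 + (N : ℝ) * C) := by
    rw [Real.rpow_add (by norm_num), Real.rpow_one]
    linarith
  rw [Real.rpow_le_rpow_left_iff (by norm_num)] at this
  linarith

end Converse

/-! ### The relaying scheme -/

section Achievability

variable {n m N : ℕ}

/-- A zero-error code with one feedback link from an encoder of user 1, the inputs of user 2 and
the input sequences `x₁` of user 1 that result, provided that the outputs determine the
messages. -/
lemma exists_code_of_injective {A B : Type} [Fintype A] [Fintype B] [Nonempty A] [Nonempty B]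
    (enc₁ : (t : ℕ) → A → (Fin t → Levels (max n m)) → Levels (max n m))
    (x₂ : B → ℕ → Levels (max n m)) (x₁ : A → B → ℕ → Levels (max n m))
    (hx₁ : ∀ a b t, enc₁ t a (fun i => output₁ n m (x₁ a b i) (x₂ b i)) = x₁ a b t)
    (h₁ : ∀ a b a' b', (∀ t < N, output₁ n m (x₁ a b t) (x₂ b t) =
      output₁ n m (x₁ a' b' t) (x₂ b' t)) → a = a')
    (h₂ : ∀ a b a' b', (∀ t < N, output₂ n m (x₁ a b t) (x₂ b t) =
      output₂ n m (x₁ a' b' t) (x₂ b' t)) → b = b') :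
    ∃ c : Code n m N (Fintype.card A) (Fintype.card B),
      c.Uses .oneLink ∧ c.errorProb₁ = 0 ∧ c.errorProb₂ = 0 := by
  classical
  let eA := Fintype.equivFin A
  let eB := Fintype.equivFin B
  let y₁ : A × B → Fin N → Levels (max n m) := fun p i =>
    output₁ n m (x₁ p.1 p.2 i) (x₂ p.2 i)
  let y₂ : A × B → Fin N → Levels (max n m) := fun p i =>
    output₂ n m (x₁ p.1 p.2 i) (x₂ p.2 i)
  -- `y₁` and `y₂` need not be injective: any preimage has the right component for its receiver.
  let c : Code n m N (Fintype.card A) (Fintype.card B) :=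
    { enc₁ := fun t w y => enc₁ t (eA.symm w) y
      enc₂ := fun t w _ => x₂ (eB.symm w) t
      dec₁ := fun y => eA (Function.invFun y₁ y).1
      dec₂ := fun y => eB (Function.invFun y₂ y).2 }
  have hin₂ : ∀ w t, c.input₂ w t = x₂ (eB.symm w.2) t := fun w t => rfl
  have hin₁ : ∀ w t, c.input₁ w t = x₁ (eA.symm w.1) (eB.symm w.2) t := by
    intro w t
    induction t using Nat.strong_induction_on with
    | _ t ih =>
      rw [← hx₁, Code.input₁, c.outputs_fst]
      change enc₁ t (eA.symm w.1) _ = _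
      congr 1
      funext i
      rw [ih i i.2, hin₂]
  have hy₁ : ∀ w : Fin _ × Fin _, (c.outputs w.1 w.2 N).1 = y₁ (eA.symm w.1, eB.symm w.2) := by
    intro w
    rw [c.outputs_fst]
    simp only [hin₁, hin₂, y₁]
  have hy₂ : ∀ w : Fin _ × Fin _, (c.outputs w.1 w.2 N).2 = y₂ (eA.symm w.1, eB.symm w.2) := by
    intro w
    rw [c.outputs_snd]
    simp only [hin₁, hin₂, y₂]
  refine ⟨c, fun t w y y' => rfl, ?_, ?_⟩
  · rw [Code.errorProb₁, Finset.filter_false_of_mem, Finset.card_empty, Nat.cast_zero, zero_div]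
    intro w _
    rw [not_not, hy₁]
    change eA _ = _
    rw [← Equiv.eq_symm_apply]
    exact h₁ _ _ _ _ fun t ht =>
      congrFun (Function.invFun_eq (f := y₁) ⟨(eA.symm w.1, eB.symm w.2), rfl⟩) ⟨t, ht⟩
  · rw [Code.errorProb₂, Finset.filter_false_of_mem, Finset.card_empty, Nat.cast_zero, zero_div]
    intro w _
    rw [not_not, hy₂]
    change eB _ = _
    rw [← Equiv.eq_symm_apply]
    exact h₂ _ _ _ _ fun t ht =>
      congrFun (Function.invFun_eq (f := y₂) ⟨(eA.symm w.1, eB.symm w.2), rfl⟩) ⟨t, ht⟩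

/-- The message bits of user 1 for time `t`, on the levels below the `m` most significant ones. -/
def freshLevels (a : Fin N → Fin (n - m) → ZMod 2) (t : ℕ) : Levels (max n m) := fun c =>
  if h : t < N ∧ m ≤ c ∧ (c : ℕ) < n then a ⟨t, h.1⟩ ⟨c - m, by omega⟩ else 0

/-- The input of user 2: uncoded message bits, and zero at the last time. -/
def uncodedLevels {q : ℕ} (b : Fin (N - 1) → Levels q) (t : ℕ) : Levels q :=
  if h : t < N - 1 then b ⟨t, h⟩ else 0

/-- User 1 sends fresh bits below the interference of user 2 received in the previous channel
use, which it learns from the feedback. -/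
def relayEnc (a : Fin N → Fin (n - m) → ZMod 2) :
    (t : ℕ) → (Fin t → Levels (max n m)) → Levels (max n m)
  | 0, _ => freshLevels a 0
  | t + 1, y => freshLevels a (t + 1) + liftTop (max n m) m
      (y (Fin.last t) - (shiftMatrix (max n m) n).mulVec (relayEnc a t (Fin.init y)))

/-- The inputs of user 1 under `relayEnc`. -/
def relayInput (a : Fin N → Fin (n - m) → ZMod 2) (b : Fin (N - 1) → Levels (max n m)) :
    ℕ → Levels (max n m)
  | 0 => freshLevels a 0
  | t + 1 => freshLevels a (t + 1) + liftTop (max n m) m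
      ((shiftMatrix (max n m) m).mulVec (uncodedLevels b t))

/-- Transmitter 1 can recompute its own last input from the earlier outputs, so subtracting its
contribution isolates the interference. -/
lemma relayEnc_eq (a : Fin N → Fin (n - m) → ZMod 2) (b : Fin (N - 1) → Levels (max n m))
    (t : ℕ) :
    relayEnc a t (fun i => output₁ n m (relayInput a b i) (uncodedLevels b i)) =
      relayInput a b t := by
  induction t with
  | zero => rfl
  | succ t ih =>
    rw [relayEnc, relayInput]
    congr 2
    have : Fin.init (fun i : Fin (t + 1) =>
        output₁ n m (relayInput a b i) (uncodedLevels b i)) =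
        fun i : Fin t => output₁ n m (relayInput a b i) (uncodedLevels b i) := rfl
    rw [this, ih]
    simp [output₁]

lemma shiftMatrix_mulVec_freshLevels (a : Fin N → Fin (n - m) → ZMod 2) (t : ℕ) :
    (shiftMatrix (max n m) m).mulVec (freshLevels a t) = 0 := by
  rw [← Matrix.mulVec_zero (shiftMatrix (max n m) m),
    shiftMatrix_mulVec_eq_iff (le_max_right _ _)]
  intro c hc
  rw [freshLevels, dif_neg (by omega)]
  rfl

lemma shiftMatrix_mulVec_relayInput_zero (a : Fin N → Fin (n - m) → ZMod 2)
    (b : Fin (N - 1) → Levels (max n m)) :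
    (shiftMatrix (max n m) m).mulVec (relayInput a b 0) = 0 :=
  shiftMatrix_mulVec_freshLevels a 0

/-- Fresh bits lie too low to cross, so only the relayed part reaches receiver 2. Both decoders rest
on this identity. -/
lemma shiftMatrix_mulVec_relayInput_succ (a : Fin N → Fin (n - m) → ZMod 2)
    (b : Fin (N - 1) → Levels (max n m)) (t : ℕ) :
    (shiftMatrix (max n m) m).mulVec (relayInput a b (t + 1)) =
      (shiftMatrix (max n m) m).mulVec (uncodedLevels b t) := by
  rw [relayInput, Matrix.mulVec_add, shiftMatrix_mulVec_freshLevels, zero_add,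
    shiftMatrix_mulVec_liftTop (le_max_right _ _)]

lemma relayInput_apply (a : Fin N → Fin (n - m) → ZMod 2) (b : Fin (N - 1) → Levels (max n m))
    (t : Fin N) (j : Fin (n - m)) :
    relayInput a b t ⟨m + j, by omega⟩ = a t j := by
  have hf : freshLevels (m := m) a t ⟨m + j, by omega⟩ = a t j := by
    rw [freshLevels, dif_pos ⟨t.2, by simp, by simp only; omega⟩]
    congr 1
    ext
    simp
  obtain ⟨t, ht⟩ := t
  cases t with
  | zero => exact hf
  | succ t =>
    simp only [relayInput, Pi.add_apply]
    rw [liftTop_apply_of_le _ _ (by simp), add_zero]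
    exact hf

lemma uncodedLevels_eq_zero {q : ℕ} (b : Fin (N - 1) → Levels q) {t : ℕ} (ht : N ≤ t + 1) :
    uncodedLevels b t = 0 :=
  dif_neg (by omega)

lemma eq_of_uncodedLevels_eq {q : ℕ} {b b' : Fin (N - 1) → Levels q}
    (h : ∀ t < N, uncodedLevels b t = uncodedLevels b' t) : b = b' := by
  funext i
  have := h i (by omega)
  simpa [uncodedLevels] using this

/-- Backward induction over the times below `N`. -/
lemma backward_induction {p : ℕ → Prop} (last : ∀ t, t + 1 = N → p t)
    (step : ∀ t, t + 1 < N → p (t + 1) → p t) : ∀ t < N, p t := by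
  intro t ht
  refine Nat.decreasingInduction' (n := N - 1) (P := p) (m := t) ?_ (by omega) (last _ (by omega))
  intro k hk _ hp
  exact step k (by omega) hp

/-- Receiver 1 decodes backwards. -/
lemma eq_of_output₁_eq {a a' : Fin N → Fin (n - m) → ZMod 2}
    {b b' : Fin (N - 1) → Levels (max n m)}
    (h : ∀ t < N, output₁ n m (relayInput a b t) (uncodedLevels b t) =
      output₁ n m (relayInput a' b' t) (uncodedLevels b' t)) : a = a' := by
  rcases Nat.lt_or_ge n m with hnm | hnm
  · funext t j
    exact absurd j.2 (by omega)
  have hP : ∀ x : Levels (max n m), (shiftMatrix (max n m) n).mulVec x = x := by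
    rw [max_eq_left hnm]
    exact shiftMatrix_mulVec_self
  simp only [output₁, hP] at h
  have key : ∀ t < N, relayInput a b t = relayInput a' b' t := by
    apply backward_induction
    · intro t ht
      have := h t (by omega)
      rwa [uncodedLevels_eq_zero b ht.ge, uncodedLevels_eq_zero b' ht.ge, add_left_inj] at this
    -- The next input, already decoded, carries the present interference on its top levels.
    · intro t ht ih
      have := h t (by omega)
      rwa [← shiftMatrix_mulVec_relayInput_succ a b, ← shiftMatrix_mulVec_relayInput_succ a' b',
        ih, add_left_inj] at this
  funext t j
  rw [← relayInput_apply a b, ← relayInput_apply a' b', key t t.2]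

/-- Receiver 2 decodes forwards for `m ≤ n` and backwards otherwise. -/
lemma eq_of_output₂_eq {a a' : Fin N → Fin (n - m) → ZMod 2}
    {b b' : Fin (N - 1) → Levels (max n m)}
    (h : ∀ t < N, output₂ n m (relayInput a b t) (uncodedLevels b t) =
      output₂ n m (relayInput a' b' t) (uncodedLevels b' t)) : b = b' := by
  apply eq_of_uncodedLevels_eq
  simp only [output₂] at h
  rcases le_total m n with hnm | hnm
  · have hP : ∀ x : Levels (max n m), (shiftMatrix (max n m) n).mulVec x = x := by
      rw [max_eq_left hnm]
      exact shiftMatrix_mulVec_self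
    simp only [hP] at h
    -- Forwards: the interference is a shift of the previous, already decoded input of user 2.
    intro t
    induction t with
    | zero =>
      intro ht
      have := h 0 ht
      rwa [shiftMatrix_mulVec_relayInput_zero, shiftMatrix_mulVec_relayInput_zero,
        add_right_inj] at this
    | succ t ih =>
      intro ht
      have := h (t + 1) ht
      rwa [shiftMatrix_mulVec_relayInput_succ, shiftMatrix_mulVec_relayInput_succ,
        ih (by omega), add_right_inj] at this
  -- Here the cross link loses nothing: user 1 relays the whole input of time `t` at `t + 1`, where
  -- the direct signal is known from the backward step.
  · have hQ : ∀ x : Levels (max n m), (shiftMatrix (max n m) m).mulVec x = x := by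
      rw [max_eq_right hnm]
      exact shiftMatrix_mulVec_self
    apply backward_induction
    · intro t ht
      rw [uncodedLevels_eq_zero b ht.ge, uncodedLevels_eq_zero b' ht.ge]
    · intro t ht ih
      have := h (t + 1) ht
      rwa [shiftMatrix_mulVec_relayInput_succ, shiftMatrix_mulVec_relayInput_succ,
        ih, add_left_inj, hQ, hQ] at this

lemma exists_relayCode (n m N : ℕ) :
    ∃ c : Code n m N (2 ^ (N * (n - m))) (2 ^ ((N - 1) * max n m)),
      c.Uses .oneLink ∧ c.errorProb₁ = 0 ∧ c.errorProb₂ = 0 := by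
  have := exists_code_of_injective (n := n) (m := m) (N := N)
    (A := Fin N → Fin (n - m) → ZMod 2) (B := Fin (N - 1) → Levels (max n m))
    (fun t a y => relayEnc a t y) uncodedLevels relayInput
    relayEnc_eq (fun _ _ _ _ => eq_of_output₁_eq) (fun _ _ _ _ => eq_of_output₂_eq)
  have hA : Fintype.card (Fin N → Fin (n - m) → ZMod 2) = 2 ^ (N * (n - m)) := by
    simp only [Fintype.card_fun, Fintype.card_fin, ZMod.card]
    rw [← pow_mul, mul_comm]
  have hB : Fintype.card (Fin (N - 1) → Levels (max n m)) = 2 ^ ((N - 1) * max n m) := by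
    simp only [Fintype.card_fun, Fintype.card_fin, ZMod.card]
    rw [← pow_mul, mul_comm]
  rwa [hA, hB] at this

lemma achievable_oneLink (n m : ℕ) {δ : ℝ} (hδ : 0 < δ) (hδ1 : δ ≤ 1) :
    Achievable .oneLink n m (((n - m : ℕ) : ℝ), (1 - δ) * ((max n m : ℕ) : ℝ)) := by
  refine ⟨by positivity, mul_nonneg (by linarith) (by positivity), fun ε hε => ?_⟩
  obtain ⟨k, hk⟩ := exists_nat_gt (1 / δ)
  -- The silent last use costs a fraction `1 / N ≤ δ` of user 2's rate; `1 ≤ N` makes `N - 1` a true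
  -- subtraction.
  refine ⟨max k 1, fun N hN => ?_⟩
  obtain ⟨c, hc, h1, h2⟩ := exists_relayCode n m N
  refine ⟨_, _, c, hc, ?_, ?_, by rw [h1]; exact hε.le, by rw [h2]; exact hε.le⟩
  · push_cast
    rw [← Real.rpow_natCast]
    push_cast
    exact le_rfl
  · have hN1 : 1 ≤ N := le_trans (le_max_right _ _) hN
    have hkN : (k : ℝ) ≤ N := by exact_mod_cast le_trans (le_max_left _ _) hN
    have hNδ : 1 ≤ (N : ℝ) * δ := by
      rw [← div_le_iff₀ hδ]
      exact (hk.trans_le hkN).le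
    rw [Nat.cast_pow, ← Real.rpow_natCast, Nat.cast_ofNat,
      Real.rpow_le_rpow_left_iff (by norm_num), Nat.cast_mul, Nat.cast_sub hN1, ← mul_assoc]
    refine mul_le_mul_of_nonneg_right ?_ (by positivity)
    push_cast
    linarith

lemma Achievable.mono_model {F : FeedbackModel} {R : ℝ × ℝ} (h : Achievable .oneLink n m R) :
    Achievable F n m R := by
  cases F with
  | oneLink => exact h
  | twoLink =>
    obtain ⟨h1, h2, h⟩ := h
    refine ⟨h1, h2, fun ε hε => ?_⟩
    obtain ⟨N₀, hN₀⟩ := h ε hε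
    refine ⟨N₀, fun N hN => ?_⟩
    obtain ⟨M₁, M₂, c, -, hc⟩ := hN₀ N hN
    exact ⟨M₁, M₂, c, trivial, hc⟩

end Achievability

/-- With either feedback model the sum capacity is attained at `((n - m)⁺, max n m)`. -/
theorem isSumCapacity (F : FeedbackModel) (n m : ℕ) :
    IsSumCapacity F n m (max (n : ℝ) (m : ℝ) + max ((n : ℝ) - (m : ℝ)) 0) := by
  have hsub : ((n - m : ℕ) : ℝ) = max ((n : ℝ) - (m : ℝ)) 0 := by
    rcases le_total m n with h | h
    · rw [Nat.cast_sub h, max_eq_left]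
      exact sub_nonneg.2 (by exact_mod_cast h)
    · rw [Nat.sub_eq_zero_of_le h, Nat.cast_zero, max_eq_right]
      exact sub_nonpos.2 (by exact_mod_cast h)
  rw [← hsub, ← Nat.cast_max]
  refine IsGreatest.isLUB ⟨⟨(((n - m : ℕ) : ℝ), ((max n m : ℕ) : ℝ)), ?_, add_comm _ _⟩, ?_⟩
  -- The corner point is reached as a limit with `δ = 1 / (k + 1)`, which suffices in the closure.
  · have hlim : Filter.Tendsto
        (fun k : ℕ => ((((n - m : ℕ) : ℝ), (1 - 1 / ((k : ℝ) + 1)) * ((max n m : ℕ) : ℝ)) : ℝ × ℝ))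
        Filter.atTop (nhds (((n - m : ℕ) : ℝ), ((max n m : ℕ) : ℝ))) := by
      refine tendsto_const_nhds.prodMk_nhds ?_
      have := (tendsto_one_div_add_atTop_nhds_zero_nat (𝕜 := ℝ)).const_sub 1
      simpa using this.mul_const ((max n m : ℕ) : ℝ)
    refine mem_closure_of_tendsto hlim (Filter.Eventually.of_forall fun k => ?_)
    refine (achievable_oneLink n m (by positivity) ?_).mono_model
    rw [div_le_one (by positivity)]
    linarith [(Nat.cast_nonneg k : (0 : ℝ) ≤ k)]
  · rintro _ ⟨R, hR, rfl⟩
    have hclosed : IsClosed {R : ℝ × ℝ | R.1 + R.2 ≤ ((max n m + (n - m) : ℕ) : ℝ)} :=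
      isClosed_le (by fun_prop) continuous_const
    have hle : R.1 + R.2 ≤ ((max n m + (n - m) : ℕ) : ℝ) :=
      closure_minimal (fun _ h => Achievable.rate_add_le h) hclosed hR
    rwa [Nat.cast_add] at hle

end SymDetIC

theorem theorem2 (n m : ℕ) :
    SymDetIC.IsSumCapacity .oneLink n m
      (max (n : ℝ) (m : ℝ) + max ((n : ℝ) - (m : ℝ)) 0) ∧
    SymDetIC.IsSumCapacity .twoLink n m
      (max (n : ℝ) (m : ℝ) + max ((n : ℝ) - (m : ℝ)) 0) :=
  ⟨SymDetIC.isSumCapacity _ n m, SymDetIC.isSumCapacity _ n m⟩
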